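/- Let $X$ and $Y$ be Polish spaces with their Borel $\sigma$-algebras $\mathcal B_X,\mathcal B_Y$, and let $\mu$ on $X$ and $\nu$ on $Y$ be nonzero finite Borel measures which are nonatomic, i.e. have no atoms (an atom is a measurable set $A$ of positive measure such that each measurable $B\subset A$ has measure zero or the same measure as $A$). Let $\mathcal M_X$ be the measure algebra of $\mu$: the Borel sets modulo null sets, with metric $d(A,B)=\mu(A\,\triangle\, B)$; similarly $\mathcal M_Y$. A measure algebra map $S:\mathcal M_Y\to\mathcal M_X$ is a map which satisfies $S(Y)=X$, $S(0)=0$, commutes with finite unions and complements, and satisfies $\mu(S(B))=\nu(B)$ for all $B$; the set of these maps carries the topology of pointwise convergence. A measure space map $T:X\to Y$ is a measurable map with $\mu(T^{-1}(B))=\nu(B)$ for all $B\in\mathcal B_Y$, and maps which are equal almost everywhere are identified; $T^*:\mathcal M_Y\to\mathcal M_X$ is the measure algebra map induced by $B\mapsto T^{-1}(B)$. The space $\mathcal T(X,Y)$ of measure space maps is given the topology induced by $T\mapsto T^*$. A measure space map $T$ is a measure space isomorphism if there is a measure space map $\hat T:Y\to X$ with $\hat T\circ T=\mathrm{id}_X$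 $\mu$-a.e. and $T\circ\hat T=\mathrm{id}_Y$ $\nu$-a.e. Then: 1. $X$ and $Y$ are uncountable. 2. $T\mapsto T^*$ is a bijection, and so a homeomorphism, from $\mathcal T(X,Y)$ onto the space of measure algebra maps $\mathcal M_Y\to\mathcal M_X$. 3. A sequence $T_n$ converges to $T$ in $\mathcal T(X,Y)$ if and only if $\mu\big(T_n^{-1}(E)\,\triangle\, T^{-1}(E)\big)\to 0$ for each Borel set $E\subset Y$. 4. $\mathcal T(X,Y)$ is completely metrizable, and the set of measure space isomorphisms is a dense $G_\delta$ subset of it. In particular this set is residual: the generic measure space map $X\to Y$ is a measure space isomorphism. -/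

import Mathlib

open MeasureTheory Filter Topology
open scoped symmDiff ENNReal

noncomputable section

namespace InvertibleMaps

section MeasureAlgebra

variable {X : Type*} [MeasurableSpace X]

/-- An atom of `μ`: a measurable set of positive measure such that each measurable subset has
either the same measure or measure zero. -/
def IsAtomSet (μ : Measure X) (A : Set X) : Prop :=
  MeasurableSet A ∧ 0 < μ A ∧ ∀ B, MeasurableSet B → B ⊆ A → μ B = μ A ∨ μ B = 0

/-- A measure is nonatomic when it has no atoms. -/
def Nonatomic (μ : Measure X) : Prop := ∀ A : Set X, ¬ IsAtomSet μ A

/-- The measure algebra of `μ`: measurable sets with the pseudometric `d(A, B) = μ (A ∆ B)`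
(this is Mathlib's `MeasuredSets μ`), where sets at distance zero are identified. It carries the
quotient topology, which is the topology of the metric induced by `d`. -/
abbrev MeasureAlgebra (μ : Measure X) : Type _ := SeparationQuotient (MeasuredSets μ)

namespace MeasureAlgebra

variable {μ : Measure X}

/-- The class of a measurable set. -/
def mk (μ : Measure X) (s : Set X) (hs : MeasurableSet s) : MeasureAlgebra μ :=
  SeparationQuotient.mk (⟨s, hs⟩ : MeasuredSets μ)

theorem inseparable_iff {s t : MeasuredSets μ} :
    Inseparable s t ↔ (s : Set X) =ᵐ[μ] (t : Set X) := by
  rw [EMetric.inseparable_iff, MeasuredSets.edist_def, measure_symmDiff_eq_zero_iff]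

theorem mk_eq_mk_iff {s t : Set X} {hs : MeasurableSet s} {ht : MeasurableSet t} :
    mk μ s hs = mk μ t ht ↔ s =ᵐ[μ] t :=
  SeparationQuotient.mk_eq_mk.trans inseparable_iff

/-- The class `0` of the sets of measure zero. -/
def zero (μ : Measure X) : MeasureAlgebra μ := mk μ ∅ MeasurableSet.empty

/-- The class of the sets of full measure. -/
def one (μ : Measure X) : MeasureAlgebra μ := mk μ Set.univ MeasurableSet.univ

/-- Union of classes. -/
def union (a b : MeasureAlgebra μ) : MeasureAlgebra μ :=
  SeparationQuotient.lift₂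
    (fun s t : MeasuredSets μ => mk μ ((s : Set X) ∪ t) (s.2.union t.2))
    (fun _ _ _ _ h₁ h₂ => mk_eq_mk_iff.2
      (ae_eq_set_union (inseparable_iff.1 h₁) (inseparable_iff.1 h₂))) a b

/-- Complement of a class. -/
def compl (a : MeasureAlgebra μ) : MeasureAlgebra μ :=
  SeparationQuotient.lift
    (fun s : MeasuredSets μ => mk μ ((s : Set X)ᶜ) s.2.compl)
    (fun _ _ h => mk_eq_mk_iff.2 (ae_eq_set_compl_compl.2 (inseparable_iff.1 h))) a

/-- The measure of a class. -/
def measure (a : MeasureAlgebra μ) : ℝ≥0∞ :=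
  SeparationQuotient.lift (fun s : MeasuredSets μ => μ (s : Set X))
    (fun _ _ h => measure_congr (inseparable_iff.1 h)) a

end MeasureAlgebra

end MeasureAlgebra

section Maps

variable {X Y : Type*} [MeasurableSpace X] [MeasurableSpace Y]

/-- Measure algebra maps `S` from the measure algebra of `ν` to the measure algebra of `μ`. -/
@[ext]
structure MeasureAlgebraMap (ν : Measure Y) (μ : Measure X) where
  toFun : MeasureAlgebra ν → MeasureAlgebra μ
  map_one : toFun (MeasureAlgebra.one ν) = MeasureAlgebra.one μ
  map_zero : toFun (MeasureAlgebra.zero ν) = MeasureAlgebra.zero μ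
  map_union : ∀ a b, toFun (a.union b) = (toFun a).union (toFun b)
  map_compl : ∀ a, toFun a.compl = (toFun a).compl
  map_measure : ∀ a, (toFun a).measure = a.measure

/-- The topology of pointwise convergence on measure algebra maps. -/
instance (ν : Measure Y) (μ : Measure X) : TopologicalSpace (MeasureAlgebraMap ν μ) :=
  TopologicalSpace.induced (fun S a => S.toFun a) Pi.topologicalSpace

/-- Almost everywhere equality of measurable measure preserving functions. -/
instance aeSetoid (μ : Measure X) (ν : Measure Y) : Setoid {T : X → Y // MeasurePreserving T μ ν} where
  r T₁ T₂ := T₁.1 =ᵐ[μ] T₂.1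
  iseqv := ⟨fun _ => ae_eq_refl _, fun h => h.symm, fun h₁ h₂ => h₁.trans h₂⟩

/-- The space of measure space maps `(X, μ) → (Y, ν)`: measurable measure preserving functions,
where functions which are equal almost everywhere are identified. -/
def MeasureSpaceMap (μ : Measure X) (ν : Measure Y) : Type _ := Quotient (aeSetoid μ ν)

variable {μ : Measure X} {ν : Measure Y}

/-- The class of a measure preserving function. -/
def MeasureSpaceMap.mk (T : X → Y) (hT : MeasurePreserving T μ ν) : MeasureSpaceMap μ ν :=
  Quotient.mk (aeSetoid μ ν) ⟨T, hT⟩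

/-- The measure algebra map induced by `B ↦ T ⁻¹' B`. -/
def pullback (T : X → Y) (hT : MeasurePreserving T μ ν) : MeasureAlgebraMap ν μ where
  toFun := SeparationQuotient.lift
    (fun s : MeasuredSets ν => MeasureAlgebra.mk μ (T ⁻¹' (s : Set Y)) (hT.measurable s.2))
    (fun _ _ h => MeasureAlgebra.mk_eq_mk_iff.2
      (hT.quasiMeasurePreserving.preimage_ae_eq (MeasureAlgebra.inseparable_iff.1 h)))
  map_one := rfl
  map_zero := rfl
  map_union a b := by
    obtain ⟨s, rfl⟩ := SeparationQuotient.surjective_mk a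
    obtain ⟨t, rfl⟩ := SeparationQuotient.surjective_mk b
    rfl
  map_compl a := by
    obtain ⟨s, rfl⟩ := SeparationQuotient.surjective_mk a
    rfl
  map_measure a := by
    obtain ⟨s, rfl⟩ := SeparationQuotient.surjective_mk a
    exact hT.measure_preimage s.2.nullMeasurableSet

/-- The map `T ↦ T*` from measure space maps to measure algebra maps. -/
def MeasureSpaceMap.star (T : MeasureSpaceMap μ ν) : MeasureAlgebraMap ν μ :=
  Quotient.lift (fun T : {T : X → Y // MeasurePreserving T μ ν} => pullback T.1 T.2)
    (fun T₁ T₂ h => by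
      have h' : T₁.1 =ᵐ[μ] T₂.1 := h
      ext a
      obtain ⟨s, rfl⟩ := SeparationQuotient.surjective_mk a
      refine MeasureAlgebra.mk_eq_mk_iff.2 ?_
      filter_upwards [h'] with x hx
      exact congrArg (fun y => y ∈ (s : Set Y)) hx) T

/-- The topology on the space of measure space maps: `T` is identified with `T*`, and measure
algebra maps carry the topology of pointwise convergence. -/
instance (μ : Measure X) (ν : Measure Y) : TopologicalSpace (MeasureSpaceMap μ ν) :=
  TopologicalSpace.induced MeasureSpaceMap.star inferInstance

/-- A measure preserving function `T` is a measure space isomorphism when there is a measure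
preserving function in the other direction which is inverse to `T` almost everywhere. -/
def IsMeasureSpaceIso (μ : Measure X) (ν : Measure Y) (T : X → Y) : Prop :=
  MeasurePreserving T μ ν ∧
    ∃ R : Y → X, MeasurePreserving R ν μ ∧ R ∘ T =ᵐ[μ] id ∧ T ∘ R =ᵐ[ν] id

/-- The set of (classes of) measure space isomorphisms. -/
def isoSet (μ : Measure X) (ν : Measure Y) : Set (MeasureSpaceMap μ ν) :=
  {q | ∃ (T : X → Y) (hT : MeasurePreserving T μ ν),
    MeasureSpaceMap.mk T hT = q ∧ IsMeasureSpaceIso μ ν T}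

end Maps

end InvertibleMaps

end

/-!
The space of measure space maps is studied through the measure algebras. A measure algebra map
preserves the metric `μ (s ∆ t)`, because that metric is expressed by the Boolean operations and
the measure, and measure algebras are complete.

*Point realization.* An uncountable standard Borel space `Y` is Borel isomorphic to `ℕ → Bool`.
Given a measure preserving Boolean homomorphism on the countable algebra generated by the
coordinate sets, choose representatives of the images of these sets: they are the coordinates of a
point map (`exists_measurePreserving_of_cylinderAlgebra`). As that algebra is dense, every measure
algebra map is a pullback `T*`. The same lemma shows that restriction to the algebra is a closed
embedding of the space of measure algebra maps into a countable power of the complete measure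
algebra of `μ` (`isClosedEmbedding_comp_cylinderClass`), which gives complete metrizability.

*Isomorphisms.* A map `T` is an isomorphism exactly when `T*` is surjective (`mem_isoSet_iff`):
the inverse of `T*` is then itself a pullback. Since the range of an isometry of complete spaces
is closed, it suffices to approximate countably many classes, so that the isomorphisms form a
countable intersection of open sets (`isoSet_eq_iInter`).

*Density.* By Baire's theorem it is enough that each of these open sets is dense. Given `T`,
finitely many sets in `Y` and a set `A` in `X`, some measure space map has the same preimages of
these sets as `T` and has `A` as a further preimage (`exists_star_eq_on_finset`). It is glued from
measure preserving maps between parts of equal mass, and those come from distribution and quantile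
functions, which is possible in the absence of atoms (`exists_measurePreserving_comp_ae_eq`). When
`μ` and `ν` have different total mass the space of maps is empty and density holds trivially.
-/

open MeasureTheory Filter Topology
open scoped symmDiff ENNReal

noncomputable section

namespace InvertibleMaps

/-! ### The measure algebra as a complete metric space -/

section MeasureAlgebra

variable {X : Type*} [MeasurableSpace X] {μ : Measure X}

/-- A sequence of sets with `μ (uₙ ∆ uₘ) < 2⁻ᴺ` for `n, m ≥ N` converges to its upper limit: a point
where the upper limit differs from `u_N` lies in some `uₙ ∆ uₙ₊₁` with `n ≥ N`. -/
instance MeasuredSets.instCompleteSpace : CompleteSpace (MeasuredSets μ) := by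
  refine EMetric.complete_of_convergent_controlled_sequences (fun n => (2⁻¹ : ℝ≥0∞) ^ n)
    (fun n => ENNReal.pow_pos (by simp) n) fun u hu => ?_
  let s : Set X := limsup (fun n => (u n : Set X)) atTop
  have hs : MeasurableSet s := MeasurableSet.measurableSet_limsup fun n => (u n).2
  refine ⟨⟨s, hs⟩, ?_⟩
  have hsub : ∀ N, (u N : Set X) ∆ s ⊆ ⋃ n, (u (N + n) : Set X) ∆ u (N + n + 1) := by
    intro N x hx
    by_contra hcon
    simp only [Set.mem_iUnion, not_exists, Set.mem_symmDiff, not_or, not_and, not_not] at hcon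
    have key : ∀ n, x ∈ (u (N + n) : Set X) ↔ x ∈ (u N : Set X) := by
      intro n
      induction n with
      | zero => rfl
      | succ n ih => exact Iff.trans ⟨(hcon n).2, (hcon n).1⟩ ih
    have hxs : x ∈ s ↔ x ∈ (u N : Set X) := by
      simp only [s, mem_limsup_iff_frequently_mem]
      constructor
      · intro h
        obtain ⟨n, hn, hxn⟩ := (frequently_atTop.1 h) N
        obtain ⟨k, rfl⟩ := Nat.exists_eq_add_of_le hn
        exact (key k).1 hxn
      · intro h
        refine Eventually.frequently ?_
        filter_upwards [eventually_ge_atTop N] with n hn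
        obtain ⟨k, rfl⟩ := Nat.exists_eq_add_of_le hn
        exact (key k).2 h
    rw [Set.mem_symmDiff, hxs] at hx
    tauto
  have hbound : ∀ N, edist (u N) ⟨s, hs⟩ ≤ 2⁻¹ ^ N * 2 := by
    intro N
    calc μ ((u N : Set X) ∆ s)
        ≤ ∑' n, μ ((u (N + n) : Set X) ∆ u (N + n + 1)) :=
          (measure_mono (hsub N)).trans (measure_iUnion_le _)
      _ ≤ ∑' n, (2⁻¹ : ℝ≥0∞) ^ (N + n) :=
          ENNReal.tsum_le_tsum fun n => (hu (N + n) _ _ le_rfl (Nat.le_succ _)).le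
      _ = 2⁻¹ ^ N * 2 := by
          simp_rw [pow_add, ENNReal.tsum_mul_left, ENNReal.tsum_geometric]
          simp
  refine tendsto_iff_edist_tendsto_0.2 (tendsto_of_tendsto_of_tendsto_of_le_of_le
    tendsto_const_nhds ?_ (fun _ => zero_le) hbound)
  have := ENNReal.Tendsto.mul_const (b := 2)
    (ENNReal.tendsto_pow_atTop_nhds_zero_of_lt_one (r := 2⁻¹) (by simp)) (Or.inr (by simp))
  simpa using this

namespace MeasureAlgebra

theorem edist_mk_mk {s t : Set X} (hs : MeasurableSet s) (ht : MeasurableSet t) :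
    edist (mk μ s hs) (mk μ t ht) = μ (s ∆ t) := rfl

theorem measure_mk {s : Set X} (hs : MeasurableSet s) : (mk μ s hs).measure = μ s := rfl

theorem compl_mk {s : Set X} (hs : MeasurableSet s) :
    (mk μ s hs).compl = mk μ sᶜ hs.compl := rfl

theorem union_mk {s t : Set X} (hs : MeasurableSet s) (ht : MeasurableSet t) :
    (mk μ s hs).union (mk μ t ht) = mk μ (s ∪ t) (hs.union ht) := rfl

theorem exists_mk_eq (a : MeasureAlgebra μ) : ∃ (s : Set X) (hs : MeasurableSet s),
    mk μ s hs = a := by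
  obtain ⟨s, rfl⟩ := SeparationQuotient.surjective_mk a
  exact ⟨s.1, s.2, rfl⟩

/-- The metric of the measure algebra in terms of its Boolean operations and its measure. -/
theorem edist_eq_measure (a b : MeasureAlgebra μ) :
    edist a b = ((a.compl.union b).compl.union (b.compl.union a).compl).measure := by
  obtain ⟨s, hs, rfl⟩ := exists_mk_eq a
  obtain ⟨t, ht, rfl⟩ := exists_mk_eq b
  change μ (s ∆ t) = μ ((sᶜ ∪ t)ᶜ ∪ (tᶜ ∪ s)ᶜ)
  congr 1
  ext x
  simp only [Set.mem_symmDiff, Set.mem_union, Set.mem_compl_iff]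
  tauto

theorem eq_zero_of_measure_eq_zero {a : MeasureAlgebra μ} (h : a.measure = 0) : a = zero μ := by
  obtain ⟨s, hs, rfl⟩ := exists_mk_eq a
  exact mk_eq_mk_iff.2 (ae_eq_empty.2 h)

theorem continuous_measure : Continuous (measure : MeasureAlgebra μ → ℝ≥0∞) :=
  SeparationQuotient.continuous_lift MeasuredSets.continuous_measure

theorem isometry_compl : Isometry (compl : MeasureAlgebra μ → MeasureAlgebra μ) := by
  intro a b
  obtain ⟨s, hs, rfl⟩ := exists_mk_eq a
  obtain ⟨t, ht, rfl⟩ := exists_mk_eq b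
  simp only [compl_mk, edist_mk_mk, compl_symmDiff_compl]

theorem edist_union_union_le (a b a' b' : MeasureAlgebra μ) :
    edist (a.union b) (a'.union b') ≤ edist a a' + edist b b' := by
  obtain ⟨s, hs, rfl⟩ := exists_mk_eq a
  obtain ⟨t, ht, rfl⟩ := exists_mk_eq b
  obtain ⟨s', hs', rfl⟩ := exists_mk_eq a'
  obtain ⟨t', ht', rfl⟩ := exists_mk_eq b'
  simp only [union_mk, edist_mk_mk]
  exact (measure_mono (by grind)).trans (measure_union_le (s ∆ s') (t ∆ t'))

theorem continuous_union :
    Continuous fun p : MeasureAlgebra μ × MeasureAlgebra μ => p.1.union p.2 := by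
  refine LipschitzWith.continuous (K := 2) fun p q => ?_
  calc edist (p.1.union p.2) (q.1.union q.2) ≤ edist p.1 q.1 + edist p.2 q.2 :=
        edist_union_union_le _ _ _ _
    _ ≤ edist p q + edist p q := add_le_add (le_max_left _ _) (le_max_right _ _)
    _ = (2 : NNReal) * edist p q := by simp [two_mul]

end MeasureAlgebra

end MeasureAlgebra

section Maps

variable {X Y : Type*} [MeasurableSpace X] [MeasurableSpace Y] {μ : Measure X} {ν : Measure Y}

/-- Measure algebra maps preserve the metric, because they preserve all that defines it. -/
theorem MeasureAlgebraMap.isometry (S : MeasureAlgebraMap ν μ) : Isometry S.toFun := by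
  intro a b
  rw [MeasureAlgebra.edist_eq_measure, MeasureAlgebra.edist_eq_measure, ← S.map_measure]
  simp only [S.map_union, S.map_compl]

theorem MeasureAlgebraMap.toFun_injective :
    Function.Injective (MeasureAlgebraMap.toFun : MeasureAlgebraMap ν μ → _) :=
  fun _ _ h => MeasureAlgebraMap.ext h

theorem MeasureAlgebraMap.continuous_apply (a : MeasureAlgebra ν) :
    Continuous fun S : MeasureAlgebraMap ν μ => S.toFun a :=
  (_root_.continuous_apply a).comp continuous_induced_dom

theorem star_mk_apply_mk (T : X → Y) (hT : MeasurePreserving T μ ν) {s : Set Y}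
    (hs : MeasurableSet s) :
    (MeasureSpaceMap.mk T hT).star.toFun (MeasureAlgebra.mk ν s hs) =
      MeasureAlgebra.mk μ (T ⁻¹' s) (hT.measurable hs) := rfl

theorem MeasureSpaceMap.exists_mk_eq (q : MeasureSpaceMap μ ν) :
    ∃ (T : X → Y) (hT : MeasurePreserving T μ ν), MeasureSpaceMap.mk T hT = q := by
  obtain ⟨⟨T, hT⟩, rfl⟩ := Quotient.exists_rep q
  exact ⟨T, hT, rfl⟩

theorem MeasureSpaceMap.mk_eq_mk_iff {T₁ T₂ : X → Y} {h₁ : MeasurePreserving T₁ μ ν}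
    {h₂ : MeasurePreserving T₂ μ ν} :
    MeasureSpaceMap.mk T₁ h₁ = MeasureSpaceMap.mk T₂ h₂ ↔ T₁ =ᵐ[μ] T₂ :=
  Quotient.eq (r := aeSetoid μ ν)

end Maps

/-- A nonatomic measure does not charge points, since a point of positive mass is an atom. -/
theorem Nonatomic.nullSingletonClass {X : Type*} [MeasurableSpace X] [MeasurableSingletonClass X]
    {μ : Measure X} (h : Nonatomic μ) : NullSingletonClass μ where
  measure_singleton x := by
    by_contra hx
    refine h {x} ⟨measurableSet_singleton x, pos_iff_ne_zero.2 hx, fun B _ hB => ?_⟩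
    rcases Set.subset_singleton_iff_eq.1 hB with rfl | rfl <;> simp

theorem uncountable_of_nonatomic {X : Type*} [MeasurableSpace X] [MeasurableSingletonClass X]
    {μ : Measure X} (h0 : μ ≠ 0) (h : Nonatomic μ) : Uncountable X := by
  have := h.nullSingletonClass
  by_contra hc
  rw [not_uncountable_iff] at hc
  exact h0 (Measure.measure_univ_eq_zero.1 (Set.countable_univ.measure_zero μ))

/-! ### Measure algebra maps are induced by point maps -/

section PointRealization

variable {X Y : Type*} [MeasurableSpace X] [MeasurableSpace Y] {μ : Measure X} {ν : Measure Y}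

/-- The countable algebra of sets generated by the coordinate sets of `ℕ → Bool`, transported to
`Y`. -/
def cylinderAlgebra (e : Y ≃ᵐ (ℕ → Bool)) : Set (Set Y) :=
  generateSetAlgebra (Set.range fun n => e ⁻¹' {z | z n = true})

theorem countable_cylinderAlgebra (e : Y ≃ᵐ (ℕ → Bool)) : (cylinderAlgebra e).Countable :=
  countable_generateSetAlgebra (Set.countable_range _)

theorem isSetAlgebra_cylinderAlgebra (e : Y ≃ᵐ (ℕ → Bool)) : IsSetAlgebra (cylinderAlgebra e) :=
  isSetAlgebra_generateSetAlgebra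

theorem generateFrom_cylinderAlgebra (e : Y ≃ᵐ (ℕ → Bool)) :
    MeasurableSpace.generateFrom (cylinderAlgebra e) = ‹MeasurableSpace Y› := by
  rw [cylinderAlgebra, generateFrom_generateSetAlgebra_eq]
  refine le_antisymm (MeasurableSpace.generateFrom_le ?_) ?_
  · rintro _ ⟨n, rfl⟩
    exact ((measurable_pi_apply n).comp e.measurable) (measurableSet_singleton true)
  · have : @Measurable _ _ (MeasurableSpace.generateFrom
        (Set.range fun n => e ⁻¹' {z | z n = true})) _ e := by
      refine @measurable_pi_lambda _ _ _ (MeasurableSpace.generateFrom _) _ _ fun n => ?_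
      refine @measurable_to_bool _ (MeasurableSpace.generateFrom _) _ ?_
      exact MeasurableSpace.measurableSet_generateFrom ⟨n, rfl⟩
    exact e.measurableEmbedding.comap_eq.symm.le.trans this.comap_le

theorem measurableSet_of_mem_cylinderAlgebra (e : Y ≃ᵐ (ℕ → Bool)) {s : Set Y}
    (hs : s ∈ cylinderAlgebra e) : MeasurableSet s := by
  rw [← generateFrom_cylinderAlgebra e]
  exact MeasurableSpace.measurableSet_generateFrom hs

/-- The classes of the sets in the cylinder algebra. -/
def cylinderClass (e : Y ≃ᵐ (ℕ → Bool)) (ν : Measure Y) (s : cylinderAlgebra e) :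
    MeasureAlgebra ν :=
  MeasureAlgebra.mk ν s (measurableSet_of_mem_cylinderAlgebra e s.2)

theorem denseRange_cylinderClass (e : Y ≃ᵐ (ℕ → Bool)) (ν : Measure Y) [IsFiniteMeasure ν] :
    DenseRange (cylinderClass e ν) := by
  have h := dense_of_generateFrom_isSetRing (μ := ν) (isSetAlgebra_cylinderAlgebra e).isSetRing
    ⟨{Set.univ}, Set.countable_singleton _,
      Set.singleton_subset_iff.2 (isSetAlgebra_cylinderAlgebra e).univ_mem, by simp⟩
    (generateFrom_cylinderAlgebra e).symm
  refine (SeparationQuotient.surjective_mk.denseRange.dense_image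
    SeparationQuotient.continuous_mk h).mono ?_
  rintro _ ⟨s, hs, rfl⟩
  exact ⟨⟨s, hs⟩, rfl⟩

/-- A measure preserving Boolean homomorphism `f` from the cylinder algebra to the measure algebra
of `μ` is realized by a point map: for each `n`, a representative of the class which `f` assigns to
the `n`-th coordinate set is the preimage of that set. -/
theorem exists_measurePreserving_of_cylinderAlgebra [IsFiniteMeasure ν] (e : Y ≃ᵐ (ℕ → Bool))
    (f : cylinderAlgebra e → MeasureAlgebra μ)
    (hcompl : ∀ s : cylinderAlgebra e,
      f ⟨sᶜ, (isSetAlgebra_cylinderAlgebra e).compl_mem s.2⟩ = (f s).compl)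
    (hunion : ∀ s t : cylinderAlgebra e,
      f ⟨s ∪ t, (isSetAlgebra_cylinderAlgebra e).union_mem s.2 t.2⟩ = (f s).union (f t))
    (hmeas : ∀ s : cylinderAlgebra e, (f s).measure = ν s) :
    ∃ (T : X → Y) (hT : MeasurePreserving T μ ν),
      ∀ s, (MeasureSpaceMap.mk T hT).star.toFun (cylinderClass e ν s) = f s := by
  classical
  choose A hA hAf using fun n => MeasureAlgebra.exists_mk_eq
    (f ⟨e ⁻¹' {z | z n = true}, generateSetAlgebra.base _ ⟨n, rfl⟩⟩)
  let T : X → Y := fun x => e.symm fun n => decide (x ∈ A n)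
  have hT : Measurable T := e.symm.measurable.comp <| measurable_pi_lambda _ fun n =>
    measurable_to_bool (by
      have : (fun x => decide (x ∈ A n)) ⁻¹' {true} = A n := by ext; simp
      rw [this]; exact hA n)
  have key : ∀ s (hs : s ∈ cylinderAlgebra e) (hms : MeasurableSet (T ⁻¹' s)),
      MeasureAlgebra.mk μ (T ⁻¹' s) hms = f ⟨s, hs⟩ := by
    intro s hs
    induction hs with
    | base s hs =>
      obtain ⟨n, rfl⟩ := hs
      intro hms
      rw [← hAf n]
      refine MeasureAlgebra.mk_eq_mk_iff.2 (Eventually.of_forall fun x => propext ?_)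
      change (e (e.symm _)) n = true ↔ x ∈ A n
      rw [e.apply_symm_apply]
      simp
    | empty =>
      intro hms
      exact (MeasureAlgebra.eq_zero_of_measure_eq_zero ((hmeas _).trans measure_empty)).symm
    | compl s hs ih =>
      intro hms
      rw [hcompl ⟨s, hs⟩, ← ih (by simpa using hms.compl)]
      rfl
    | union s t hs ht ihs iht =>
      intro hms
      rw [hunion ⟨s, hs⟩ ⟨t, ht⟩, ← ihs (hT (measurableSet_of_mem_cylinderAlgebra e hs)),
        ← iht (hT (measurableSet_of_mem_cylinderAlgebra e ht))]
      rfl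
  have hval : ∀ s ∈ cylinderAlgebra e, ν s = μ.map T s := by
    intro s hs
    have hms := hT (measurableSet_of_mem_cylinderAlgebra e hs)
    rw [Measure.map_apply hT (measurableSet_of_mem_cylinderAlgebra e hs), ← hmeas ⟨s, hs⟩,
      ← key s hs hms, MeasureAlgebra.measure_mk]
  have hmp : MeasurePreserving T μ ν := ⟨hT, Eq.symm <|
    ext_of_generate_finite (cylinderAlgebra e) (generateFrom_cylinderAlgebra e).symm
      (isSetAlgebra_cylinderAlgebra e).isSetRing.isSetSemiring.isPiSystem hval
      (hval _ (isSetAlgebra_cylinderAlgebra e).univ_mem)⟩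
  exact ⟨T, hmp, fun s => key s s.2 _⟩

theorem star_surjective_of_equiv [IsFiniteMeasure ν] (e : Y ≃ᵐ (ℕ → Bool)) :
    Function.Surjective (MeasureSpaceMap.star : MeasureSpaceMap μ ν → MeasureAlgebraMap ν μ) := by
  intro S
  obtain ⟨T, hT, h⟩ := exists_measurePreserving_of_cylinderAlgebra (μ := μ) (ν := ν) e
    (fun s => S.toFun (cylinderClass e ν s)) (fun s => S.map_compl (cylinderClass e ν s))
    (fun s t => S.map_union (cylinderClass e ν s) (cylinderClass e ν t)) (fun s => S.map_measure _)
  refine ⟨MeasureSpaceMap.mk T hT, MeasureAlgebraMap.toFun_injective ?_⟩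
  exact (denseRange_cylinderClass e ν).equalizer
    (MeasureAlgebraMap.isometry _).continuous S.isometry.continuous (funext h)

/-- Point maps with the same preimages modulo null sets agree almost everywhere, because countably
many measurable sets separate the points of `Y`. -/
theorem star_injective [MeasurableSpace.CountablySeparated Y] :
    Function.Injective (MeasureSpaceMap.star : MeasureSpaceMap μ ν → MeasureAlgebraMap ν μ) := by
  intro q₁ q₂ h
  obtain ⟨T₁, h₁, rfl⟩ := q₁.exists_mk_eq
  obtain ⟨T₂, h₂, rfl⟩ := q₂.exists_mk_eq
  refine MeasureSpaceMap.mk_eq_mk_iff.2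
    (Filter.EventuallyEq.of_forall_separating_preimage MeasurableSet fun U hU => ?_)
  exact MeasureAlgebra.mk_eq_mk_iff.1
    (congrArg (fun S => S.toFun (MeasureAlgebra.mk ν U hU)) h)

theorem isHomeomorph_star [StandardBorelSpace Y] [Uncountable Y] [IsFiniteMeasure ν] :
    IsHomeomorph (MeasureSpaceMap.star : MeasureSpaceMap μ ν → MeasureAlgebraMap ν μ) :=
  isHomeomorph_iff_isEmbedding_surjective.2 ⟨⟨⟨rfl⟩, star_injective⟩, star_surjective_of_equiv
    (PolishSpace.measurableEquivNatBoolOfNotCountable (not_countable_iff.2 ‹_›))⟩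

theorem tendsto_mk_iff {ι : Type*} {l : Filter ι} {T : ι → X → Y}
    {hT : ∀ n, MeasurePreserving (T n) μ ν} {T₀ : X → Y} {hT₀ : MeasurePreserving T₀ μ ν} :
    Tendsto (fun n => MeasureSpaceMap.mk (T n) (hT n)) l (𝓝 (MeasureSpaceMap.mk T₀ hT₀)) ↔
      ∀ E : Set Y, MeasurableSet E → Tendsto (fun n => μ ((T n ⁻¹' E) ∆ (T₀ ⁻¹' E))) l (𝓝 0) := by
  have h₁ : IsInducing (MeasureSpaceMap.star : MeasureSpaceMap μ ν → _) := ⟨rfl⟩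
  have h₂ : IsInducing (fun (S : MeasureAlgebraMap ν μ) a => S.toFun a) := ⟨rfl⟩
  rw [(h₂.comp h₁).tendsto_nhds_iff, tendsto_pi_nhds]
  constructor
  · intro h E hE
    exact tendsto_iff_edist_tendsto_0.1 (h (MeasureAlgebra.mk ν E hE))
  · intro h a
    obtain ⟨E, hE, rfl⟩ := MeasureAlgebra.exists_mk_eq a
    exact tendsto_iff_edist_tendsto_0.2 (h E hE)

end PointRealization

/-! ### Complete metrizability -/

section Metrizability

variable {X Y : Type*} [MeasurableSpace X] [MeasurableSpace Y] {μ : Measure X} {ν : Measure Y}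

/-- Since measure algebra maps are isometries, their pointwise convergence can be tested on the
dense cylinder algebra. -/
theorem isInducing_comp_cylinderClass [IsFiniteMeasure ν] (e : Y ≃ᵐ (ℕ → Bool)) :
    IsInducing fun (S : MeasureAlgebraMap ν μ) (s : cylinderAlgebra e) =>
      S.toFun (cylinderClass e ν s) := by
  refine ⟨le_antisymm (continuous_iff_le_induced.1 (continuous_pi fun s =>
    MeasureAlgebraMap.continuous_apply _)) ?_⟩
  set Φ := fun (S : MeasureAlgebraMap ν μ) (s : cylinderAlgebra e) =>
      S.toFun (cylinderClass e ν s)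
  let t : TopologicalSpace (MeasureAlgebraMap ν μ) := TopologicalSpace.induced Φ inferInstance
  refine continuous_iff_le_induced.1 (continuous_pi fun a => ?_)
  refine continuous_of_uniform_approx_of_continuous fun u hu => ?_
  obtain ⟨ε, hε, hεu⟩ := mem_uniformity_edist.1 hu
  obtain ⟨_, ⟨s, rfl⟩, hs⟩ := EMetric.mem_closure_iff.1 (denseRange_cylinderClass e ν a) ε hε
  refine ⟨fun S => S.toFun (cylinderClass e ν s),
    (continuous_apply s).comp (continuous_induced_dom (f := Φ)), fun S => hεu ?_⟩
  rwa [S.isometry.edist_eq]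

theorem isClosedEmbedding_comp_cylinderClass [IsFiniteMeasure ν] (e : Y ≃ᵐ (ℕ → Bool)) :
    IsClosedEmbedding fun (S : MeasureAlgebraMap ν μ) (s : cylinderAlgebra e) =>
      S.toFun (cylinderClass e ν s) := by
  refine ⟨⟨isInducing_comp_cylinderClass e,
    fun S₁ S₂ h => MeasureAlgebraMap.toFun_injective ?_⟩, ?_⟩
  · exact (denseRange_cylinderClass e ν).equalizer S₁.isometry.continuous S₂.isometry.continuous h
  -- The range consists of the measure preserving Boolean homomorphisms on the cylinder algebra.
  have hrange : (Set.range fun (S : MeasureAlgebraMap ν μ) (s : cylinderAlgebra e) =>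
      S.toFun (cylinderClass e ν s)) =
      {f : cylinderAlgebra e → MeasureAlgebra μ |
        (∀ s : cylinderAlgebra e,
          f ⟨sᶜ, (isSetAlgebra_cylinderAlgebra e).compl_mem s.2⟩ = (f s).compl) ∧
        (∀ s t : cylinderAlgebra e,
          f ⟨s ∪ t, (isSetAlgebra_cylinderAlgebra e).union_mem s.2 t.2⟩ = (f s).union (f t)) ∧
        ∀ s : cylinderAlgebra e, (f s).measure = ν s} := by
    ext f
    constructor
    · rintro ⟨S, rfl⟩
      exact ⟨fun s => S.map_compl (cylinderClass e ν s),
        fun s t => S.map_union (cylinderClass e ν s) (cylinderClass e ν t),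
        fun s => S.map_measure _⟩
    · rintro ⟨h₁, h₂, h₃⟩
      obtain ⟨T, hT, h⟩ := exists_measurePreserving_of_cylinderAlgebra e f h₁ h₂ h₃
      exact ⟨_, funext h⟩
  rw [hrange]
  simp only [Set.ofPred_and, Set.ofPred_forall]
  refine IsClosed.inter (isClosed_iInter fun s => ?_) (IsClosed.inter
    (isClosed_iInter fun s => isClosed_iInter fun t => ?_) (isClosed_iInter fun s => ?_))
  · exact isClosed_eq (continuous_apply _)
      (MeasureAlgebra.isometry_compl.continuous.comp (continuous_apply s))
  · exact isClosed_eq (continuous_apply _)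
      (MeasureAlgebra.continuous_union.comp₂ (continuous_apply s) (continuous_apply t))
  · exact isClosed_eq (MeasureAlgebra.continuous_measure.comp (continuous_apply s))
      continuous_const

theorem isCompletelyMetrizableSpace_measureSpaceMap [StandardBorelSpace Y] [Uncountable Y]
    [IsFiniteMeasure ν] : TopologicalSpace.IsCompletelyMetrizableSpace (MeasureSpaceMap μ ν) := by
  let e := PolishSpace.measurableEquivNatBoolOfNotCountable (not_countable_iff.2 ‹Uncountable Y›)
  have := (countable_cylinderAlgebra e).to_subtype
  exact ((isClosedEmbedding_comp_cylinderClass e).comp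
    isHomeomorph_star.isClosedEmbedding).IsCompletelyMetrizableSpace

end Metrizability

/-! ### Measure preserving maps between nonatomic spaces -/

section Existence

/-- The distribution function of a probability measure on the unit interval without point masses
is continuous. -/
theorem continuous_measureReal_Iic (μ : Measure unitInterval) [IsProbabilityMeasure μ]
    [NullSingletonClass μ] : Continuous fun x : unitInterval => μ.real (Set.Iic x) := by
  have h : (fun x : unitInterval => μ.real (Set.Iic x)) =
      fun x => ∫ y, (Set.Iic x).indicator (fun _ => (1 : ℝ)) y ∂μ := by
    ext x
    rw [integral_indicator measurableSet_Iic]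
    simp
  rw [h, continuous_iff_continuousAt]
  intro x
  refine continuousAt_of_dominated (bound := fun _ => 1)
    (Eventually.of_forall fun z =>
      (measurable_const.indicator measurableSet_Iic).aestronglyMeasurable)
    (Eventually.of_forall fun z => Eventually.of_forall fun y => ?_) (integrable_const _) ?_
  · by_cases hy : y ∈ Set.Iic z <;> simp [hy]
  · have hne : ∀ᵐ y ∂μ, y ≠ x := by
      rw [ae_iff]; simp
    filter_upwards [hne] with y hy
    rcases lt_or_gt_of_ne hy with hyx | hyx
    · refine ContinuousAt.congr (f := fun _ => (1 : ℝ)) continuousAt_const ?_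
      filter_upwards [lt_mem_nhds hyx] with z hz
      simp [hz.le]
    · refine ContinuousAt.congr (f := fun _ => (0 : ℝ)) continuousAt_const ?_
      filter_upwards [gt_mem_nhds hyx] with z hz
      simp [hz]

/-- The probability integral transform: the distribution function of a probability measure without
point masses carries it to Lebesgue measure. -/
theorem exists_measurePreserving_unitInterval (μ : Measure unitInterval) [IsProbabilityMeasure μ]
    [NullSingletonClass μ] : ∃ F : unitInterval → unitInterval, MeasurePreserving F μ volume := by
  let F : unitInterval → unitInterval := fun x =>
    ⟨μ.real (Set.Iic x), measureReal_nonneg, measureReal_le_one⟩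
  have hF : Continuous F := (continuous_measureReal_Iic μ).subtype_mk _
  have hmono : Monotone F := fun x y hxy =>
    measureReal_mono (Set.Iic_subset_Iic.2 hxy)
  have h0 : F 0 = 0 := by
    apply Subtype.ext
    have : Set.Iic (0 : unitInterval) = {0} := Set.Iic_bot
    simp [F, this, Measure.real]
  have h1 : F 1 = 1 := by
    apply Subtype.ext
    have : Set.Iic (1 : unitInterval) = Set.univ := Set.Iic_top
    simp [F, this]
  refine ⟨F, hF.measurable, ?_⟩
  have : IsProbabilityMeasure (μ.map F) := Measure.isProbabilityMeasure_map hF.aemeasurable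
  refine Measure.ext_of_Iic _ _ fun t => ?_
  -- The largest `x` with `F x ≤ t` satisfies `F x = t` by the intermediate value theorem.
  obtain ⟨x, hxt, hx⟩ : ∃ x, IsGreatest (F ⁻¹' Set.Iic t) x :=
    (isClosed_Iic.preimage hF).isCompact.exists_isGreatest ⟨0, by simp [h0]⟩
  have hpre : F ⁻¹' Set.Iic t = Set.Iic x :=
    Set.Subset.antisymm (fun y hy => hx hy) fun y hy => (hmono hy).trans hxt
  have hFx : F x = t := by
    obtain ⟨y, hy⟩ := intermediate_value_univ 0 1 hF
      (show t ∈ Set.Icc (F 0) (F 1) by rw [h0, h1]; exact ⟨t.2.1, t.2.2⟩)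
    refine le_antisymm hxt ?_
    rw [← hy]
    exact hmono (hx (show F y ≤ t from hy.le))
  rw [Measure.map_apply hF.measurable measurableSet_Iic, hpre, unitInterval.volume_Iic, ← hFx,
    ofReal_measureReal]

variable {X Y : Type*} [MeasurableSpace X] [StandardBorelSpace X] [MeasurableSpace Y]
  [StandardBorelSpace Y]

/-- A measure without point masses can be carried to any measure of the same total mass: both are
related to Lebesgue measure on the unit interval, by the distribution function of the first and the
quantile function of the second. -/
theorem exists_measurePreserving_of_measure_univ_eq [Nonempty Y] (μ : Measure X)
    [IsFiniteMeasure μ] [NullSingletonClass μ] (ν : Measure Y)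
    (h : μ Set.univ = ν Set.univ) : ∃ G : X → Y, MeasurePreserving G μ ν := by
  by_cases h0 : μ Set.univ = 0
  · have hμ := Measure.measure_univ_eq_zero.1 h0
    have hν := Measure.measure_univ_eq_zero.1 (h ▸ h0)
    exact ⟨fun _ => Classical.arbitrary Y, measurable_const, by simp [hμ, hν]⟩
  have htop : μ Set.univ ≠ ∞ := measure_ne_top _ _
  have hc0 : (μ Set.univ)⁻¹ ≠ 0 := ENNReal.inv_ne_zero.2 htop
  have hct : (μ Set.univ)⁻¹ ≠ ∞ := ENNReal.inv_ne_top.2 h0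
  have hμp : IsProbabilityMeasure ((μ Set.univ)⁻¹ • μ) :=
    ⟨by simp [ENNReal.inv_mul_cancel h0 htop]⟩
  have hνp : IsProbabilityMeasure ((μ Set.univ)⁻¹ • ν) :=
    ⟨by simp [← h, ENNReal.inv_mul_cancel h0 htop]⟩
  have he := measurableEmbedding_sigmoid_comp_embeddingReal X
  set e := unitInterval.sigmoid ∘ embeddingReal X
  let μI : Measure unitInterval := ((μ Set.univ)⁻¹ • μ).map e
  have : IsProbabilityMeasure μI := Measure.isProbabilityMeasure_map he.measurable.aemeasurable
  have : NullSingletonClass μI := ⟨fun x => by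
    simp only [μI]
    rw [he.map_apply, Measure.smul_apply,
      (Set.subsingleton_singleton.preimage he.injective).measure_zero, smul_zero]⟩
  obtain ⟨F, hF⟩ := exists_measurePreserving_unitInterval μI
  obtain ⟨Q, hQ, hQν⟩ := Measure.exists_measurable_map_eq ((μ Set.univ)⁻¹ • ν)
  have hcomp : MeasurePreserving (Q ∘ F ∘ e) ((μ Set.univ)⁻¹ • μ) ((μ Set.univ)⁻¹ • ν) :=
    MeasurePreserving.comp ⟨hQ, hQν⟩ (hF.comp ⟨he.measurable, rfl⟩)
  refine ⟨Q ∘ F ∘ e, hcomp.measurable, ?_⟩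
  have := congrArg (fun m => (μ Set.univ) • m) hcomp.map_eq
  simpa [Measure.map_smul, smul_smul, ENNReal.mul_inv_cancel h0 htop] using this

theorem sum_restrict_preimage_singleton {Z ι : Type*} [MeasurableSpace Z] [Countable ι]
    [MeasurableSpace ι] [MeasurableSingletonClass ι] (m : Measure Z) {r : Z → ι}
    (hr : Measurable r) : Measure.sum (fun i => m.restrict (r ⁻¹' {i})) = m := by
  rw [← Measure.restrict_iUnion (fun i j hij => Disjoint.preimage r (by simpa using hij))
    (fun i => hr (measurableSet_singleton i)),
    show ⋃ i, r ⁻¹' {i} = Set.univ by ext; simp, Measure.restrict_univ]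

/-- If `p` and `q` label the points of `X` and `Y` by countably many labels with the same
distribution, then some measure preserving map respects the labels: glue maps between the parts of
equal label, which have equal mass. -/
theorem exists_measurePreserving_comp_ae_eq {ι : Type*} [Countable ι] [MeasurableSpace ι]
    [MeasurableSingletonClass ι] [Nonempty Y] (μ : Measure X) [IsFiniteMeasure μ]
    [NullSingletonClass μ] (ν : Measure Y) {p : X → ι} {q : Y → ι} (hp : Measurable p)
    (hq : Measurable q) (h : μ.map p = ν.map q) :
    ∃ T : X → Y, MeasurePreserving T μ ν ∧ q ∘ T =ᵐ[μ] p := by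
  have hps : ∀ i, MeasurableSet (p ⁻¹' {i}) := fun i => hp (measurableSet_singleton i)
  have hqs : ∀ i, MeasurableSet (q ⁻¹' {i}) := fun i => hq (measurableSet_singleton i)
  have hmass : ∀ i, μ.restrict (p ⁻¹' {i}) Set.univ = ν.restrict (q ⁻¹' {i}) Set.univ := fun i => by
    rw [Measure.restrict_apply_univ, Measure.restrict_apply_univ,
      ← Measure.map_apply hp (measurableSet_singleton i), h,
      Measure.map_apply hq (measurableSet_singleton i)]
  choose G hG using fun i => exists_measurePreserving_of_measure_univ_eq
    (μ.restrict (p ⁻¹' {i})) (ν.restrict (q ⁻¹' {i})) (hmass i)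
  have hT : Measurable fun x => G (p x) x :=
    (measurable_from_prod_countable_right (f := fun z : ι × X => G z.1 z.2)
      fun i => (hG i).measurable).comp (hp.prodMk measurable_id)
  have hTi : ∀ i, (fun x => G (p x) x) =ᵐ[μ.restrict (p ⁻¹' {i})] G i := fun i => by
    filter_upwards [ae_restrict_mem (hps i)] with x hx
    rw [show p x = i from hx]
  have hsumX := sum_restrict_preimage_singleton μ hp
  have hsumY := sum_restrict_preimage_singleton ν hq
  refine ⟨_, ⟨hT, ?_⟩, ?_⟩
  · conv_lhs => rw [← hsumX]
    rw [Measure.map_sum hT.aemeasurable]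
    conv_rhs => rw [← hsumY]
    congr 1
    ext1 i
    rw [Measure.map_congr (hTi i), (hG i).map_eq]
  · rw [← hsumX]
    refine Measure.ae_sum_iff.2 fun i => ?_
    have hmem : ∀ᵐ x ∂μ.restrict (p ⁻¹' {i}), G i x ∈ q ⁻¹' {i} :=
      (hG i).quasiMeasurePreserving.ae (ae_restrict_mem (hqs i))
    filter_upwards [hmem, hTi i, ae_restrict_mem (hps i)] with x hx hTx hpx
    simp only [Function.comp_apply, hTx]
    exact (show q (G i x) = i from hx).trans (show p x = i from hpx).symm

end Existence

/-! ### Isomorphisms are the maps with surjective pullback -/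

section Isomorphism

variable {X Y Z : Type*} [MeasurableSpace X] [MeasurableSpace Y] [MeasurableSpace Z]
  {μ : Measure X} {ν : Measure Y} {ρ : Measure Z}

theorem star_mk_comp (T : X → Y) (hT : MeasurePreserving T μ ν) (R : Y → Z)
    (hR : MeasurePreserving R ν ρ) (a : MeasureAlgebra ρ) :
    (MeasureSpaceMap.mk (R ∘ T) (hR.comp hT)).star.toFun a =
      (MeasureSpaceMap.mk T hT).star.toFun ((MeasureSpaceMap.mk R hR).star.toFun a) := by
  obtain ⟨s, hs, rfl⟩ := MeasureAlgebra.exists_mk_eq a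
  rfl

theorem star_mk_id (a : MeasureAlgebra μ) :
    (MeasureSpaceMap.mk id (MeasurePreserving.id μ)).star.toFun a = a := by
  obtain ⟨s, hs, rfl⟩ := MeasureAlgebra.exists_mk_eq a
  rfl

/-- The inverse of a surjective measure algebra map. -/
def MeasureAlgebraMap.inverse (S : MeasureAlgebraMap ν μ) (h : Function.Surjective S.toFun) :
    MeasureAlgebraMap μ ν where
  toFun := Function.surjInv h
  map_one := S.isometry.injective <| by rw [Function.surjInv_eq h, S.map_one]
  map_zero := S.isometry.injective <| by rw [Function.surjInv_eq h, S.map_zero]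
  map_union a b := S.isometry.injective <| by
    simp only [S.map_union, Function.surjInv_eq h]
  map_compl a := S.isometry.injective <| by simp only [S.map_compl, Function.surjInv_eq h]
  map_measure a := by rw [← S.map_measure, Function.surjInv_eq h]

/-- If `T*` is surjective then its inverse is a measure algebra map, hence induced by a point map,
which is inverse to `T` because composition of point maps is determined by that of pullbacks. -/
theorem mem_isoSet_iff [StandardBorelSpace X] [Uncountable X] [StandardBorelSpace Y]
    [IsFiniteMeasure μ] (q : MeasureSpaceMap μ ν) :
    q ∈ isoSet μ ν ↔ Function.Surjective q.star.toFun := by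
  constructor
  · rintro ⟨T, hT, rfl, -, R, hR, hRT, -⟩ a
    refine ⟨(MeasureSpaceMap.mk R hR).star.toFun a, ?_⟩
    rw [← star_mk_comp, MeasureSpaceMap.mk_eq_mk_iff (h₂ := MeasurePreserving.id μ) |>.2 hRT,
      star_mk_id]
  · intro h
    obtain ⟨T, hT, rfl⟩ := q.exists_mk_eq
    obtain ⟨r, hr⟩ := (isHomeomorph_star (μ := ν) (ν := μ)).surjective
      ((MeasureSpaceMap.mk T hT).star.inverse h)
    obtain ⟨R, hR, rfl⟩ := r.exists_mk_eq
    have hR' : (MeasureSpaceMap.mk R hR).star.toFun = Function.surjInv h := by rw [hr]; rfl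
    refine ⟨T, hT, rfl, hT, R, hR, ?_, ?_⟩
    · refine (MeasureSpaceMap.mk_eq_mk_iff (h₁ := hR.comp hT) (h₂ := MeasurePreserving.id μ)).1
        (star_injective (MeasureAlgebraMap.toFun_injective (funext fun a => ?_)))
      rw [star_mk_comp T hT R hR, star_mk_id, hR', Function.surjInv_eq h]
    · refine (MeasureSpaceMap.mk_eq_mk_iff (h₁ := hT.comp hR) (h₂ := MeasurePreserving.id ν)).1
        (star_injective (MeasureAlgebraMap.toFun_injective (funext fun a => ?_)))
      rw [star_mk_comp R hR T hT, star_mk_id, hR']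
      exact Function.leftInverse_surjInv
        ⟨(MeasureAlgebraMap.isometry _).injective, h⟩ a

end Isomorphism

/-! ### Genericity of isomorphisms -/

section Generic

variable {X Y : Type*} [MeasurableSpace X] [MeasurableSpace Y] {μ : Measure X} {ν : Measure Y}

/-- The range of `q*` comes closer than `ε` to `a`. -/
def approxSet (ν : Measure Y) (a : MeasureAlgebra μ) (ε : ℝ≥0∞) : Set (MeasureSpaceMap μ ν) :=
  {q | ∃ b, edist a (q.star.toFun b) < ε}

theorem isOpen_approxSet (a : MeasureAlgebra μ) (ε : ℝ≥0∞) : IsOpen (approxSet ν a ε) := by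
  have : approxSet ν a ε = ⋃ b, {q | edist a (q.star.toFun b) < ε} := by
    ext q; simp [approxSet]
  rw [this]
  refine isOpen_iUnion fun b => isOpen_lt (continuous_const.edist ?_) continuous_const
  exact (MeasureAlgebraMap.continuous_apply b).comp continuous_induced_dom

/-- Since pullbacks are isometries of complete spaces, they have closed range, so surjectivity is
approximate surjectivity onto a dense set of classes. -/
theorem isoSet_eq_iInter [StandardBorelSpace X] [Uncountable X] [StandardBorelSpace Y]
    [IsFiniteMeasure μ] (e : X ≃ᵐ (ℕ → Bool)) :
    isoSet μ ν = ⋂ (s : cylinderAlgebra e) (n : ℕ),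
      approxSet ν (cylinderClass e μ s) ((n : ℝ≥0∞) + 1)⁻¹ := by
  ext q
  rw [mem_isoSet_iff]
  simp only [Set.mem_iInter]
  constructor
  · intro h s n
    obtain ⟨b, hb⟩ := h (cylinderClass e μ s)
    exact ⟨b, by rw [hb, edist_self]; simp [ENNReal.add_eq_top]⟩
  · intro h
    have hclosed : IsClosed (Set.range q.star.toFun) :=
      q.star.isometry.isClosedEmbedding.isClosed_range
    have hsub : Set.range (cylinderClass e μ) ⊆ Set.range q.star.toFun := by
      rintro _ ⟨s, rfl⟩
      rw [← hclosed.closure_eq, EMetric.mem_closure_iff]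
      intro ε hε
      obtain ⟨n, hn⟩ := ENNReal.exists_inv_nat_lt hε.ne'
      obtain ⟨b, hb⟩ := h s n
      refine ⟨_, ⟨b, rfl⟩, hb.trans_le (le_trans ?_ hn.le)⟩
      exact ENNReal.inv_le_inv.2 le_self_add
    exact Set.range_eq_univ.1 (Set.univ_subset_iff.1
      ((denseRange_cylinderClass e μ).closure_eq ▸ hclosed.closure_subset_iff.2 hsub))

variable [StandardBorelSpace X] [StandardBorelSpace Y]

theorem measurable_decide_mem {W : Type*} [MeasurableSpace W] {E : Set W}
    [DecidablePred (· ∈ E)] (hE : MeasurableSet E) : Measurable fun w => decide (w ∈ E) :=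
  measurable_to_bool (by
    have : (fun w => decide (w ∈ E)) ⁻¹' {true} = E := by ext; simp
    rwa [this])

/-- Label the points of `Y` by the finitely many sets of `I` which contain them, and those of `X`
by the labels of their images under `T`. A measure preserving map `R : Y → X` which respects the
labels shows that the label of `x` together with the truth value of `x ∈ A` has the same
distribution on `X` as the label of `y` together with that of `y ∈ R ⁻¹' A` has on `Y`. A map
`X → Y` respecting these refined labels agrees with `T` on `I`, and pulls `R ⁻¹' A` back to `A`. -/
theorem exists_star_eq_on_finset [Nonempty X] [Nonempty Y] [IsFiniteMeasure μ] [IsFiniteMeasure ν]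
    [NullSingletonClass μ] [NullSingletonClass ν] (q : MeasureSpaceMap μ ν)
    (I : Finset (MeasureAlgebra ν)) (a : MeasureAlgebra μ) :
    ∃ q' : MeasureSpaceMap μ ν, (∀ b ∈ I, q'.star.toFun b = q.star.toFun b) ∧
      a ∈ Set.range q'.star.toFun := by
  classical
  obtain ⟨T, hT, rfl⟩ := q.exists_mk_eq
  obtain ⟨A, hA, rfl⟩ := MeasureAlgebra.exists_mk_eq a
  choose B hB hBmk using fun b : MeasureAlgebra ν => MeasureAlgebra.exists_mk_eq b
  let l : Y → I → Bool := fun y b => decide (y ∈ B b)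
  have hl : Measurable l := measurable_pi_lambda _ fun b => measurable_decide_mem (hB b)
  obtain ⟨R, hR, hRl⟩ := exists_measurePreserving_comp_ae_eq ν μ hl (hl.comp hT.measurable)
    (by rw [← Measure.map_map hl hT.measurable, hT.map_eq])
  let p : X → (I → Bool) × Bool := fun x => (l (T x), decide (x ∈ A))
  let r : Y → (I → Bool) × Bool := fun y => (l y, decide (R y ∈ A))
  have hp : Measurable p := (hl.comp hT.measurable).prodMk (measurable_decide_mem hA)
  have hr : Measurable r := hl.prodMk (measurable_decide_mem (hR.measurable hA))
  have hpr : μ.map p = ν.map r := by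
    rw [← hR.map_eq, Measure.map_map hp hR.measurable]
    refine Measure.map_congr ?_
    filter_upwards [hRl] with y hy
    exact Prod.ext hy rfl
  obtain ⟨T', hT', hT'p⟩ := exists_measurePreserving_comp_ae_eq μ ν hp hr hpr
  refine ⟨MeasureSpaceMap.mk T' hT', fun b hb => ?_,
    MeasureAlgebra.mk ν (R ⁻¹' A) (hR.measurable hA), ?_⟩
  · rw [← hBmk b, star_mk_apply_mk, star_mk_apply_mk, MeasureAlgebra.mk_eq_mk_iff]
    filter_upwards [hT'p] with x hx
    have := congrFun (congrArg Prod.fst hx) ⟨b, hb⟩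
    exact propext (decide_eq_decide.1 this)
  · rw [star_mk_apply_mk, MeasureAlgebra.mk_eq_mk_iff]
    filter_upwards [hT'p] with x hx
    exact propext (decide_eq_decide.1 (congrArg Prod.snd hx))

/-- Pointwise convergence only tests finitely many classes at a time. -/
theorem dense_approxSet [Nonempty X] [Nonempty Y] [IsFiniteMeasure μ] [IsFiniteMeasure ν]
    [NullSingletonClass μ] [NullSingletonClass ν] (a : MeasureAlgebra μ) {ε : ℝ≥0∞} (hε : 0 < ε) :
    Dense (approxSet ν a ε) := by
  classical
  intro q
  choose f hf hfa using fun I => exists_star_eq_on_finset q I a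
  refine mem_closure_of_tendsto (b := (atTop : Filter (Finset (MeasureAlgebra ν)))) (f := f) ?_
    (Eventually.of_forall fun I => ?_)
  · have h₁ : IsInducing (MeasureSpaceMap.star : MeasureSpaceMap μ ν → _) := ⟨rfl⟩
    have h₂ : IsInducing (fun (S : MeasureAlgebraMap ν μ) a => S.toFun a) := ⟨rfl⟩
    rw [(h₂.comp h₁).tendsto_nhds_iff, tendsto_pi_nhds]
    intro b
    refine tendsto_const_nhds.congr' ?_
    filter_upwards [eventually_ge_atTop {b}] with I hI
    exact (hf I b (hI (Finset.mem_singleton_self b))).symm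
  · obtain ⟨b, hb⟩ := hfa I
    exact ⟨b, by rwa [hb, edist_self]⟩

end Generic

end InvertibleMaps

end

theorem theorem3p10
    {X Y : Type*}
    [TopologicalSpace X] [PolishSpace X] [MeasurableSpace X] [BorelSpace X]
    [TopologicalSpace Y] [PolishSpace Y] [MeasurableSpace Y] [BorelSpace Y]
    (μ : Measure X) [IsFiniteMeasure μ] (hμ0 : μ ≠ 0) (hμ : InvertibleMaps.Nonatomic μ)
    (ν : Measure Y) [IsFiniteMeasure ν] (hν0 : ν ≠ 0) (hν : InvertibleMaps.Nonatomic ν) :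
    -- both spaces are uncountable
    (Uncountable X ∧ Uncountable Y) ∧
    -- `T ↦ T*` identifies measure space maps mod a.e. equality with measure algebra maps
    IsHomeomorph (InvertibleMaps.MeasureSpaceMap.star :
      InvertibleMaps.MeasureSpaceMap μ ν → InvertibleMaps.MeasureAlgebraMap ν μ) ∧
    -- convergence of sequences in the space of measure space maps
    (∀ (T : ℕ → X → Y) (hT : ∀ n, MeasurePreserving (T n) μ ν)
        (T₀ : X → Y) (hT₀ : MeasurePreserving T₀ μ ν),
      Tendsto (fun n => InvertibleMaps.MeasureSpaceMap.mk (T n) (hT n)) atTop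
          (𝓝 (InvertibleMaps.MeasureSpaceMap.mk T₀ hT₀)) ↔
        ∀ E : Set Y, MeasurableSet E →
          Tendsto (fun n => μ ((T n ⁻¹' E) ∆ (T₀ ⁻¹' E))) atTop (𝓝 0)) ∧
    -- the space of measure space maps is completely metrizable
    TopologicalSpace.IsCompletelyMetrizableSpace (InvertibleMaps.MeasureSpaceMap μ ν) ∧
    -- the isomorphisms form a dense `Gδ` set, so that the generic map is an isomorphism
    IsGδ (InvertibleMaps.isoSet μ ν) ∧
    Dense (InvertibleMaps.isoSet μ ν) ∧
    InvertibleMaps.isoSet μ ν ∈ residual (InvertibleMaps.MeasureSpaceMap μ ν) := by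
  have hX : Uncountable X := InvertibleMaps.uncountable_of_nonatomic hμ0 hμ
  have hY : Uncountable Y := InvertibleMaps.uncountable_of_nonatomic hν0 hν
  have := hμ.nullSingletonClass
  have := hν.nullSingletonClass
  have hcm : TopologicalSpace.IsCompletelyMetrizableSpace (InvertibleMaps.MeasureSpaceMap μ ν) :=
    InvertibleMaps.isCompletelyMetrizableSpace_measureSpaceMap
  let e := PolishSpace.measurableEquivNatBoolOfNotCountable (not_countable_iff.2 hX)
  have := (InvertibleMaps.countable_cylinderAlgebra e).to_subtype
  have hGδ : IsGδ (InvertibleMaps.isoSet μ ν) := by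
    rw [InvertibleMaps.isoSet_eq_iInter e]
    exact .iInter fun s => .iInter_of_isOpen fun n => InvertibleMaps.isOpen_approxSet _ _
  have hdense : Dense (InvertibleMaps.isoSet μ ν) := by
    let _ := TopologicalSpace.upgradeIsCompletelyMetrizable (InvertibleMaps.MeasureSpaceMap μ ν)
    rw [InvertibleMaps.isoSet_eq_iInter e]
    refine dense_iInter_of_Gδ (fun s => .iInter_of_isOpen fun n =>
      InvertibleMaps.isOpen_approxSet _ _) fun s => dense_iInter_of_isOpen (fun n =>
      InvertibleMaps.isOpen_approxSet _ _) fun n => InvertibleMaps.dense_approxSet _ ?_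
    exact ENNReal.inv_pos.2 (by simp [ENNReal.add_eq_top])
  exact ⟨⟨hX, hY⟩, InvertibleMaps.isHomeomorph_star, fun _ _ _ _ => InvertibleMaps.tendsto_mk_iff,
    hcm, hGδ, hdense, residual_of_dense_Gδ hGδ hdense⟩
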